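/- Theorem (Open Mapping Theorem). Let $\mathbb{H}$ be the real algebra of quaternions, let $\mathbb{S}=\{q\in\mathbb{H} : q^2=-1\}$ be the sphere of imaginary units, and for $I\in\mathbb{S}$ let $L_I=\mathbb{R}+I\mathbb{R}$, identified with $\mathbb{C}$. For $x,y\in\mathbb{R}$ write $x+y\mathbb{S}=\{x+yJ : J\in\mathbb{S}\}$. A domain is a nonempty connected open set. Let $\Omega\subseteq\mathbb{H}$ be a symmetric slice domain; that is, $\Omega$ is a domain of $\mathbb{H}$ which intersects the real axis, the slice $\Omega_I=\Omega\cap L_I$ is a domain in $L_I$ for every $I\in\mathbb{S}$, and, whenever $x+yI\in\Omega$ with $x,y\in\mathbb{R}$ and $I\in\mathbb{S}$, the whole set $x+y\mathbb{S}$ is contained in $\Omega$. Let $f:\Omega\to\mathbb{H}$ be (slice) regular; that is, for every $I\in\mathbb{S}$ the restriction $f_I=f|_{\Omega_I}$ is of class $C^1$ and $$\frac12\left(\frac{\partial}{\partial x}+I\frac{\partial}{\partial y}\right)f_I(x+Iy)=0\qquad\text{for all } x+Iy\in\Omega_I .$$ Let $D_f\subseteq\Omega$ be the degenerate set of $f$,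 i.e. the union of all the 2-spheres $x+y\mathbb{S}\subseteq\Omega$ (with $x,y\in\mathbb{R}$, $y\neq0$) on which $f$ is constant, and let $\overline{D_f}$ be its closure. Then the restriction $f:\Omega\setminus\overline{D_f}\to\mathbb{H}$ is an open map, i.e. $f(U)$ is open in $\mathbb{H}$ for every open subset $U$ of $\Omega\setminus\overline{D_f}$. -/

import Mathlib

open scoped Quaternion

noncomputable section

namespace SliceRegular

/-- The two-sphere of quaternionic imaginary units. -/
def imagUnits : Set ℍ := {q | q ^ 2 = -1}

/-- The point `x + y I`, where `z = x + i y`. For an imaginary unit `I` this identifies the complex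
plane with the complex line `ℝ + I ℝ` in the quaternions. -/
def slicePoint (I : ℍ[ℝ]) (z : ℂ) : ℍ[ℝ] := (z.re : ℍ[ℝ]) + (z.im : ℍ[ℝ]) * I

/-- The slice of `Ω` by the complex line `ℝ + I ℝ`, read in the complex plane. -/
def slice (Ω : Set ℍ) (I : ℍ[ℝ]) : Set ℂ := {z | slicePoint I z ∈ Ω}

/-- The restriction of `f` to the complex line `ℝ + I ℝ`, read in the complex plane. -/
def sliceFun (f : ℍ[ℝ] → ℍ[ℝ]) (I : ℍ[ℝ]) : ℂ → ℍ[ℝ] := fun z => f (slicePoint I z)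

/-- The Cauchy-Riemann operator `(1/2) (∂/∂x + I ∂/∂y)` applied to the restriction of `f` to
`ℝ + I ℝ`, where `I` multiplies on the left. -/
def dbar (I : ℍ[ℝ]) (f : ℍ[ℝ] → ℍ[ℝ]) (z : ℂ) : ℍ[ℝ] :=
  (1 / 2 : ℝ) • (fderiv ℝ (sliceFun f I) z 1 + I * fderiv ℝ (sliceFun f I) z Complex.I)

/-- A domain: a nonempty connected open set. -/
def IsDomainSet {X : Type*} [TopologicalSpace X] (s : Set X) : Prop :=
  IsOpen s ∧ IsConnected s

/-- The function `f` is (slice) regular on `Ω`: its restriction to each slice of `Ω` is of class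
`C^1` and is annihilated by the Cauchy-Riemann operator of that slice. Only the values of `f` on
`Ω` matter when `Ω` is open. -/
def IsRegularOn (f : ℍ[ℝ] → ℍ[ℝ]) (Ω : Set ℍ) : Prop :=
  ∀ I ∈ imagUnits,
    ContDiffOn ℝ 1 (sliceFun f I) (slice Ω I) ∧ ∀ z ∈ slice Ω I, dbar I f z = 0

/-- A slice domain: a domain of the quaternions that meets the real axis and whose slices are all
domains of the corresponding complex lines. -/
def IsSliceDomain (Ω : Set ℍ) : Prop :=
  IsDomainSet Ω ∧ (∃ x : ℝ, (x : ℍ[ℝ]) ∈ Ω) ∧ ∀ I ∈ imagUnits, IsDomainSet (slice Ω I)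

/-- The set `x + y 𝕊`. -/
def sphere (x y : ℝ) : Set ℍ := {q | ∃ J ∈ imagUnits, q = (x : ℍ[ℝ]) + (y : ℍ[ℝ]) * J}

/-- Axial symmetry: with each point `x + y I` the set contains the whole sphere `x + y 𝕊`. -/
def IsSymmetric (C : Set ℍ) : Prop :=
  ∀ (x y : ℝ), ∀ I ∈ imagUnits, (x : ℍ[ℝ]) + (y : ℍ[ℝ]) * I ∈ C → sphere x y ⊆ C

/-- The degenerate set of a function `f` on `Ω`: the union of the spheres `x + y 𝕊` in `Ω`, with
`y ≠ 0`, on which `f` is constant. -/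
def degenerateSet (f : ℍ[ℝ] → ℍ[ℝ]) (Ω : Set ℍ) : Set ℍ :=
  {q | ∃ x y : ℝ, y ≠ 0 ∧ sphere x y ⊆ Ω ∧ (∃ c : ℍ[ℝ], ∀ p ∈ sphere x y, f p = c) ∧
    q ∈ sphere x y}

end SliceRegular

end

open Filter Topology Set Metric ComplexConjugate
open scoped RealInnerProductSpace

namespace SliceRegular

/-! ### Imaginary units -/

/-! On each sphere a regular function is affine in the imaginary unit: `f (x + yJ) = a z + J * b z`
with `z = x + iy` (`representation_formula`), and the components of `a + i b` are holomorphic in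
`z`. Solving `f = w` thus becomes a problem in one complex variable. Extending the squared norm of
the quaternions complex-bilinearly and evaluating it at `a - w + i b` gives the holomorphic function
`N_w = ‖a - w‖² - ‖b‖² + 2i⟪a - w, b⟫` (`symmetrization`). It vanishes at `z` exactly when some unit
`J` satisfies `a z + J * b z = w`; if `b z ≠ 0`, that unit is `-(a z - w) (b z)⁻¹`.

Let `f q = w₀`, with `q` over `z₀`. If `N_{w₀}` vanished near `z₀`, then `f` would be constant and
`closure D_f` would contain `Ω`. Otherwise the zero `z₀` is isolated and persists nearby for all `w`
close to `w₀` (`eventually_exists_zero_of_continuousAt`), giving preimages of `w` on spheres close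
to that of `q`. They are close to `q` itself: for real `z₀` the spheres are small, and for nonreal
`z₀` nondegeneracy gives `b z₀ ≠ 0`, so `J` depends continuously on `(w, z)`. -/

theorem mem_imagUnits_iff {q : ℍ[ℝ]} : q ∈ imagUnits ↔ q.re = 0 ∧ Quaternion.normSq q = 1 := by
  have key : q ∈ imagUnits ↔ q * q = -1 := by rw [imagUnits, Set.mem_ofPred_eq, sq]
  rw [key, Quaternion.ext_iff, Quaternion.normSq_def']
  simp only [Quaternion.re_mul, Quaternion.imI_mul, Quaternion.imJ_mul, Quaternion.imK_mul,
    Quaternion.re_neg, Quaternion.imI_neg, Quaternion.imJ_neg, Quaternion.imK_neg,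
    Quaternion.re_one, Quaternion.imI_one, Quaternion.imJ_one, Quaternion.imK_one]
  constructor
  · rintro ⟨h0, h1, h2, h3⟩
    have hre : q.re = 0 := by
      by_contra hne
      have e1 : q.imI = 0 := by
        have : q.re * q.imI = 0 := by linarith
        simpa [hne] using this
      have e2 : q.imJ = 0 := by
        have : q.re * q.imJ = 0 := by linarith
        simpa [hne] using this
      have e3 : q.imK = 0 := by
        have : q.re * q.imK = 0 := by linarith
        simpa [hne] using this
      rw [e1, e2, e3] at h0
      nlinarith [mul_self_nonneg q.re]
    refine ⟨hre, ?_⟩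
    rw [hre] at h0 ⊢
    linarith
  · rintro ⟨hre, h⟩
    rw [hre] at h ⊢
    refine ⟨by linarith, by ring, by ring, by ring⟩

theorem mul_self_of_mem_imagUnits {I : ℍ[ℝ]} (hI : I ∈ imagUnits) : I * I = -1 := by
  rw [← sq]; exact hI

theorem mul_mul_self_of_mem_imagUnits {I : ℍ[ℝ]} (hI : I ∈ imagUnits) (q : ℍ[ℝ]) :
    I * (I * q) = -q := by
  rw [← mul_assoc, mul_self_of_mem_imagUnits hI, neg_one_mul]

theorem neg_mem_imagUnits {I : ℍ[ℝ]} (hI : I ∈ imagUnits) : -I ∈ imagUnits := by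
  change (-I) ^ 2 = -1
  rw [neg_sq]; exact hI

theorem norm_of_mem_imagUnits {I : ℍ[ℝ]} (hI : I ∈ imagUnits) : ‖I‖ = 1 := by
  have h := (mem_imagUnits_iff.1 hI).2
  rw [Quaternion.normSq_eq_norm_mul_self] at h
  nlinarith [norm_nonneg I]

theorem inner_mul_left_of_mem_imagUnits {I : ℍ[ℝ]} (hI : I ∈ imagUnits) (p q : ℍ[ℝ]) :
    ⟪I * p, q⟫ = -⟪p, I * q⟫ := by
  have h := (mem_imagUnits_iff.1 hI).1
  simp only [Quaternion.inner_def, Quaternion.re_mul, Quaternion.imI_mul, Quaternion.imJ_mul,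
    Quaternion.imK_mul, Quaternion.re_star, Quaternion.imI_star, Quaternion.imJ_star,
    Quaternion.imK_star, h]
  ring

theorem inner_mul_mul_of_mem_imagUnits {I : ℍ[ℝ]} (hI : I ∈ imagUnits) (p q : ℍ[ℝ]) :
    ⟪I * p, I * q⟫ = ⟪p, q⟫ := by
  rw [inner_mul_left_of_mem_imagUnits hI, mul_mul_self_of_mem_imagUnits hI, inner_neg_right,
    neg_neg]

/-! ### Slices -/

theorem slicePoint_conj (I : ℍ[ℝ]) (z : ℂ) : slicePoint I (conj z) = slicePoint (-I) z := by
  simp [slicePoint]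

theorem slicePoint_of_im_eq_zero {z : ℂ} (hz : z.im = 0) (I J : ℍ[ℝ]) :
    slicePoint I z = slicePoint J z := by
  simp [slicePoint, hz]

theorem slicePoint_mem_sphere {J : ℍ[ℝ]} (hJ : J ∈ imagUnits) (z : ℂ) :
    slicePoint J z ∈ sphere z.re z.im := ⟨J, hJ, rfl⟩

theorem IsSymmetric.slice_eq {Ω : Set ℍ[ℝ]} (hs : IsSymmetric Ω) {I J : ℍ[ℝ]}
    (hI : I ∈ imagUnits) (hJ : J ∈ imagUnits) : slice Ω I = slice Ω J :=
  Set.Subset.antisymm (fun z hz => hs z.re z.im I hI hz (slicePoint_mem_sphere hJ z))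
    (fun z hz => hs z.re z.im J hJ hz (slicePoint_mem_sphere hI z))

theorem IsSymmetric.conj_mem_slice {Ω : Set ℍ[ℝ]} (hs : IsSymmetric Ω) {I : ℍ[ℝ]}
    (hI : I ∈ imagUnits) {z : ℂ} (hz : z ∈ slice Ω I) : conj z ∈ slice Ω I := by
  change slicePoint I (conj z) ∈ Ω
  rw [slicePoint_conj]
  exact hs z.re z.im I hI hz (slicePoint_mem_sphere (neg_mem_imagUnits hI) z)

theorem imagUnits_nonempty : imagUnits.Nonempty := by
  refine ⟨⟨0, 1, 0, 0⟩, mem_imagUnits_iff.2 ⟨rfl, (Quaternion.normSq_def' _).trans ?_⟩⟩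
  norm_num

theorem exists_eq_slicePoint (q : ℍ[ℝ]) : ∃ I ∈ imagUnits, ∃ z : ℂ, q = slicePoint I z := by
  by_cases h : q.im = 0
  · obtain ⟨I, hI⟩ := imagUnits_nonempty
    refine ⟨I, hI, (q.re : ℂ), ?_⟩
    conv_lhs => rw [← Quaternion.re_add_im q, h]
    simp [slicePoint]
  · have hn : ‖q.im‖ ≠ 0 := norm_ne_zero_iff.2 h
    refine ⟨(‖q.im‖⁻¹ : ℝ) • q.im, ?_, ⟨q.re, ‖q.im‖⟩, ?_⟩
    · rw [mem_imagUnits_iff, Quaternion.normSq_eq_norm_mul_self, norm_smul, norm_inv, norm_norm,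
        inv_mul_cancel₀ hn]
      simp
    · conv_lhs => rw [← Quaternion.re_add_im q]
      rw [slicePoint, Quaternion.coe_mul_eq_smul, smul_smul, mul_inv_cancel₀ hn, one_smul]

theorem norm_slicePoint_sub_le {I : ℍ[ℝ]} (hI : I ∈ imagUnits) (z w : ℂ) :
    ‖slicePoint I z - slicePoint I w‖ ≤ 2 * ‖z - w‖ := by
  have h : slicePoint I z - slicePoint I w
      = (((z - w).re : ℝ) : ℍ[ℝ]) + (((z - w).im : ℝ) : ℍ[ℝ]) * I := by
    simp only [slicePoint, Complex.sub_re, Complex.sub_im, Quaternion.coe_sub]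
    noncomm_ring
  rw [h]
  refine (norm_add_le _ _).trans ?_
  rw [norm_mul, norm_of_mem_imagUnits hI, mul_one, Quaternion.norm_coe, Quaternion.norm_coe]
  have h1 := Complex.abs_re_le_norm (z - w)
  have h2 := Complex.abs_im_le_norm (z - w)
  simp only [Real.norm_eq_abs]
  linarith

/-! ### Holomorphic functionals of a regular function -/

/-- A real-linear functional on the quaternions with values in `ℂ` that turns left multiplication
by the imaginary unit `I` into multiplication by `i`. -/
noncomputable def sliceFunctional (I v : ℍ[ℝ]) : ℍ[ℝ] →L[ℝ] ℂ :=
  Complex.ofRealCLM.comp (innerSL ℝ v) + Complex.I • Complex.ofRealCLM.comp (innerSL ℝ (I * v))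

theorem sliceFunctional_apply (I v q : ℍ[ℝ]) :
    sliceFunctional I v q = (⟪q, v⟫ : ℂ) + (⟪q, I * v⟫ : ℂ) * Complex.I := by
  simp [sliceFunctional, real_inner_comm, mul_comm]

theorem sliceFunctional_mul {I : ℍ[ℝ]} (hI : I ∈ imagUnits) (v q : ℍ[ℝ]) :
    sliceFunctional I v (I * q) = Complex.I * sliceFunctional I v q := by
  rw [sliceFunctional_apply, sliceFunctional_apply, inner_mul_left_of_mem_imagUnits hI,
    inner_mul_mul_of_mem_imagUnits hI]
  push_cast
  linear_combination -(⟪q, I * v⟫ : ℂ) * Complex.I_mul_I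

theorem eq_of_sliceFunctional_eq {I p q : ℍ[ℝ]}
    (h : ∀ v, sliceFunctional I v p = sliceFunctional I v q) : p = q := by
  refine ext_inner_right ℝ fun v => ?_
  have := congrArg Complex.re (h v)
  simpa [sliceFunctional_apply] using this

/-- The Cauchy-Riemann equation says that the real derivative takes `i` to `I` times its value at
`1`; the functional turns that `I` back into `i`, so the composite has a complex-linear derivative.
-/
theorem differentiableOn_sliceFunctional {f : ℍ[ℝ] → ℍ[ℝ]} {Ω : Set ℍ[ℝ]}
    (hf : IsRegularOn f Ω) {I : ℍ[ℝ]} (hI : I ∈ imagUnits) (ho : IsOpen (slice Ω I)) (v : ℍ[ℝ]) :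
    DifferentiableOn ℂ (fun z => sliceFunctional I v (sliceFun f I z)) (slice Ω I) := by
  intro z hz
  have hd : DifferentiableAt ℝ (sliceFun f I) z :=
    ((hf I hI).1.contDiffAt (ho.mem_nhds hz)).differentiableAt one_ne_zero
  have hcr := (hf I hI).2 z hz
  rw [dbar, smul_eq_zero_iff_right (by norm_num)] at hcr
  have hcr' : fderiv ℝ (sliceFun f I) z Complex.I = I * fderiv ℝ (sliceFun f I) z 1 := by
    rw [eq_neg_of_add_eq_zero_left hcr, mul_neg, mul_mul_self_of_mem_imagUnits hI, neg_neg]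
  refine DifferentiableAt.differentiableWithinAt ?_
  have hfd : HasFDerivAt (fun z => sliceFunctional I v (sliceFun f I z))
      ((sliceFunctional I v).comp (fderiv ℝ (sliceFun f I) z)) z :=
    (sliceFunctional I v).hasFDerivAt.comp z hd.hasFDerivAt
  refine differentiableAt_complex_iff_differentiableAt_real.2 ⟨hfd.differentiableAt, ?_⟩
  rw [hfd.fderiv, ContinuousLinearMap.comp_apply, ContinuousLinearMap.comp_apply, hcr',
    sliceFunctional_mul hI, smul_eq_mul]

/-! ### Stem functions -/

/-- The part of `f` on the sphere of `z` that does not depend on the imaginary unit. -/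
noncomputable def stemRe (f : ℍ[ℝ] → ℍ[ℝ]) (I : ℍ[ℝ]) (z : ℂ) : ℍ[ℝ] :=
  (1 / 2 : ℝ) • (sliceFun f I z + sliceFun f I (conj z))

/-- The coefficient of the imaginary unit in `f` on the sphere of `z`. -/
noncomputable def stemIm (f : ℍ[ℝ] → ℍ[ℝ]) (I : ℍ[ℝ]) (z : ℂ) : ℍ[ℝ] :=
  (1 / 2 : ℝ) • (I * (sliceFun f I (conj z) - sliceFun f I z))

/-- The `v`-component of the stem function `stemRe + i stemIm`. -/
noncomputable def stemComp (f : ℍ[ℝ] → ℍ[ℝ]) (I v : ℍ[ℝ]) (z : ℂ) : ℂ :=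
  (⟪stemRe f I z, v⟫ : ℂ) + (⟪stemIm f I z, v⟫ : ℂ) * Complex.I

/-- The second summand is the Schwarz reflection `conj (g (conj z))` of the first, hence holomorphic
along with it. -/
theorem stemComp_eq (f : ℍ[ℝ] → ℍ[ℝ]) {I : ℍ[ℝ]} (hI : I ∈ imagUnits) (v : ℍ[ℝ]) (z : ℂ) :
    stemComp f I v z = 1 / 2 * (sliceFunctional I v (sliceFun f I z)
      + conj (sliceFunctional I v (sliceFun f I (conj z)))) := by
  simp only [stemComp, stemRe, stemIm, sliceFunctional_apply, real_inner_smul_left, inner_add_left,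
    inner_mul_left_of_mem_imagUnits hI, inner_sub_left, map_add, map_mul, Complex.conj_ofReal,
    Complex.conj_I]
  push_cast
  ring

theorem stemIm_of_im_eq_zero (f : ℍ[ℝ] → ℍ[ℝ]) (I : ℍ[ℝ]) {z : ℂ} (hz : z.im = 0) :
    stemIm f I z = 0 := by
  simp [stemIm, Complex.conj_eq_iff_im.2 hz]

theorem stemRe_of_im_eq_zero (f : ℍ[ℝ] → ℍ[ℝ]) (I : ℍ[ℝ]) {z : ℂ} (hz : z.im = 0) :
    stemRe f I z = sliceFun f I z := by
  rw [stemRe, Complex.conj_eq_iff_im.2 hz, ← two_smul ℝ, smul_smul]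
  norm_num

theorem differentiableOn_stemComp {f : ℍ[ℝ] → ℍ[ℝ]} {Ω : Set ℍ[ℝ]} (hs : IsSymmetric Ω)
    (hf : IsRegularOn f Ω) {I : ℍ[ℝ]} (hI : I ∈ imagUnits) (ho : IsOpen (slice Ω I)) (v : ℍ[ℝ]) :
    DifferentiableOn ℂ (stemComp f I v) (slice Ω I) := by
  have hd := differentiableOn_sliceFunctional hf hI ho v
  intro z hz
  have h1 := hd.differentiableAt (ho.mem_nhds hz)
  have h2 := (hd.differentiableAt (ho.mem_nhds (hs.conj_mem_slice hI hz))).conj_conj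
  rw [Complex.conj_conj] at h2
  have h3 := (h1.add h2).const_mul (1 / 2 : ℂ)
  refine DifferentiableAt.differentiableWithinAt (h3.congr_of_eventuallyEq ?_)
  exact Eventually.of_forall fun w => stemComp_eq f hI v w

/-- Here `J` need not be the unit `I` defining the stem: the candidate value on the slice of `J` is
seen to be holomorphic through components already known to be so. -/
theorem sliceFunctional_stem (f : ℍ[ℝ] → ℍ[ℝ]) (I : ℍ[ℝ]) {J : ℍ[ℝ]} (hJ : J ∈ imagUnits)
    (v : ℍ[ℝ]) (z : ℂ) : sliceFunctional J v (stemRe f I z + J * stemIm f I z)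
      = stemComp f I v z + Complex.I * stemComp f I (J * v) z := by
  simp only [sliceFunctional_apply, stemComp, inner_add_left, inner_mul_left_of_mem_imagUnits hJ,
    mul_mul_self_of_mem_imagUnits hJ, inner_neg_right]
  push_cast
  linear_combination -(⟪stemIm f I z, J * v⟫ : ℂ) * Complex.I_mul_I

/-! ### The identity principle and the representation formula -/

theorem frequently_im_eq_zero (x : ℝ) : ∃ᶠ z in 𝓝[≠] (x : ℂ), z.im = 0 := by
  have ht : Tendsto (fun t : ℝ => (t : ℂ)) (𝓝[≠] x) (𝓝[≠] (x : ℂ)) := by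
    refine tendsto_nhdsWithin_of_tendsto_nhds_of_eventually_within _
      (Complex.continuous_ofReal.continuousAt.mono_left nhdsWithin_le_nhds) ?_
    filter_upwards [self_mem_nhdsWithin] with t ht
    simpa using ht
  exact ht.frequently (Frequently.of_forall fun t => Complex.ofReal_im t)

theorem eqOn_of_eq_of_im_eq_zero {U : Set ℂ} (ho : IsOpen U) (hc : IsPreconnected U) {x : ℝ}
    (hx : (x : ℂ) ∈ U) {g h : ℂ → ℂ} (hg : DifferentiableOn ℂ g U) (hh : DifferentiableOn ℂ h U)
    (heq : ∀ z ∈ U, z.im = 0 → g z = h z) : EqOn g h U := by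
  refine (hg.analyticOnNhd ho).eqOn_of_preconnected_of_frequently_eq (hh.analyticOnNhd ho) hc hx ?_
  have hU : ∀ᶠ z in 𝓝[≠] (x : ℂ), z ∈ U := nhdsWithin_le_nhds (ho.mem_nhds hx)
  exact ((frequently_im_eq_zero x).and_eventually hU).mono fun z hz => heq z hz.2 hz.1

theorem IsSliceDomain.exists_ofReal_mem_slice {Ω : Set ℍ[ℝ]} (hΩ : IsSliceDomain Ω) (I : ℍ[ℝ]) :
    ∃ x : ℝ, (x : ℂ) ∈ slice Ω I := by
  obtain ⟨x, hx⟩ := hΩ.2.1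
  exact ⟨x, by simpa [slice, slicePoint] using hx⟩

/-- Both sides are holomorphic on the slice of `J` and agree on the real axis, where `stemIm`
vanishes; the identity principle does the rest. -/
theorem representation_formula {f : ℍ[ℝ] → ℍ[ℝ]} {Ω : Set ℍ[ℝ]} (hΩ : IsSliceDomain Ω)
    (hs : IsSymmetric Ω) (hf : IsRegularOn f Ω) {I J : ℍ[ℝ]} (hI : I ∈ imagUnits)
    (hJ : J ∈ imagUnits) {z : ℂ} (hz : z ∈ slice Ω I) :
    f (slicePoint J z) = stemRe f I z + J * stemIm f I z := by
  obtain ⟨x, hx⟩ := hΩ.exists_ofReal_mem_slice I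
  obtain ⟨ho, hc⟩ := hΩ.2.2 I hI
  have hIJ := hs.slice_eq hI hJ
  refine eq_of_sliceFunctional_eq (I := J) fun v => ?_
  have hd1 : DifferentiableOn ℂ (fun z => sliceFunctional J v (sliceFun f J z)) (slice Ω I) := by
    rw [hIJ]
    exact differentiableOn_sliceFunctional hf hJ (hIJ ▸ ho) v
  have hd2 : DifferentiableOn ℂ
      (fun z => sliceFunctional J v (stemRe f I z + J * stemIm f I z)) (slice Ω I) := by
    simp only [sliceFunctional_stem f I hJ]
    exact (differentiableOn_stemComp hs hf hI ho v).add
      ((differentiableOn_stemComp hs hf hI ho (J * v)).const_mul _)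
  refine eqOn_of_eq_of_im_eq_zero ho hc.isPreconnected hx hd1 hd2 (fun w _ hw => ?_) hz
  simp only [stemIm_of_im_eq_zero f I hw, stemRe_of_im_eq_zero f I hw, mul_zero, add_zero, sliceFun,
    slicePoint_of_im_eq_zero hw I J]

/-! ### The symmetrization of `f - w` -/

/-- The symmetrization of `f - w`, a holomorphic function of `z` that vanishes exactly where `f`
takes the value `w` somewhere on the sphere of `z`. -/
noncomputable def symmetrization (f : ℍ[ℝ] → ℍ[ℝ]) (I w : ℍ[ℝ]) (z : ℂ) : ℂ :=
  ∑ k, (stemComp f I (stdOrthonormalBasis ℝ ℍ[ℝ] k) z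
    - (⟪w, stdOrthonormalBasis ℝ ℍ[ℝ] k⟫ : ℂ)) ^ 2

theorem symmetrization_eq (f : ℍ[ℝ] → ℍ[ℝ]) (I w : ℍ[ℝ]) (z : ℂ) :
    symmetrization f I w z
      = ((‖stemRe f I z - w‖ ^ 2 - ‖stemIm f I z‖ ^ 2 : ℝ) : ℂ)
        + ((2 * ⟪stemRe f I z - w, stemIm f I z⟫ : ℝ) : ℂ) * Complex.I := by
  -- Parseval expansion of both norms and of the inner product reduces the identity to one
  -- coordinate.
  rw [← (stdOrthonormalBasis ℝ ℍ[ℝ]).sum_sq_inner_left (stemRe f I z - w),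
    ← (stdOrthonormalBasis ℝ ℍ[ℝ]).sum_sq_inner_left (stemIm f I z),
    ← (stdOrthonormalBasis ℝ ℍ[ℝ]).sum_inner_mul_inner (stemRe f I z - w) (stemIm f I z),
    ← Finset.sum_sub_distrib, Finset.mul_sum]
  push_cast
  rw [Finset.sum_mul, ← Finset.sum_add_distrib, symmetrization]
  refine Finset.sum_congr rfl fun k _ => ?_
  rw [stemComp, inner_sub_left, real_inner_comm (stemIm f I z)]
  push_cast
  linear_combination (⟪stemIm f I z, stdOrthonormalBasis ℝ ℍ[ℝ] k⟫ : ℂ) ^ 2 * Complex.I_sq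

theorem symmetrization_eq_zero_iff {f : ℍ[ℝ] → ℍ[ℝ]} {I w : ℍ[ℝ]} {z : ℂ} :
    symmetrization f I w z = 0 ↔
      ‖stemRe f I z - w‖ = ‖stemIm f I z‖ ∧ ⟪stemRe f I z - w, stemIm f I z⟫ = 0 := by
  rw [symmetrization_eq, Complex.ext_iff]
  simp [-Complex.ofReal_sub, -Complex.ofReal_mul, -Complex.ofReal_pow, sub_eq_zero]

theorem symmetrization_eq_zero_of_eq {f : ℍ[ℝ] → ℍ[ℝ]} {I w J : ℍ[ℝ]} {z : ℂ}
    (hJ : J ∈ imagUnits) (h : stemRe f I z + J * stemIm f I z = w) :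
    symmetrization f I w z = 0 := by
  have h' : stemRe f I z - w = -(J * stemIm f I z) := by rw [← h]; abel
  rw [symmetrization_eq_zero_iff, h', norm_neg, norm_mul, norm_of_mem_imagUnits hJ, one_mul,
    inner_neg_left]
  refine ⟨rfl, ?_⟩
  have := inner_mul_left_of_mem_imagUnits hJ (stemIm f I z) (stemIm f I z)
  rw [real_inner_comm (J * stemIm f I z)] at this
  linarith

/-- Since `c⁻¹` is a real multiple of `star c`, the real part of `b * c⁻¹` is a multiple of `⟪b,
c⟫`. -/
theorem mul_inv_mem_imagUnits {b c : ℍ[ℝ]} (hc : c ≠ 0) (hn : ‖b‖ = ‖c‖) (hi : ⟪b, c⟫ = 0) :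
    -(b * c⁻¹) ∈ imagUnits := by
  rw [mem_imagUnits_iff, Quaternion.normSq_eq_norm_mul_self, norm_neg, norm_mul, norm_inv, hn,
    mul_inv_cancel₀ (norm_ne_zero_iff.2 hc)]
  rw [Quaternion.inner_def] at hi
  refine ⟨?_, one_mul 1⟩
  have hinv : b * c⁻¹ = (Quaternion.normSq c)⁻¹ • (b * star c) := mul_smul_comm _ _ _
  rw [hinv, Quaternion.re_neg, Quaternion.re_smul, hi, smul_zero, neg_zero]

/-- The explicit formula for `J` is recorded for the continuity argument; when `stemIm` vanishes
every unit works. -/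
theorem exists_of_symmetrization_eq_zero {f : ℍ[ℝ] → ℍ[ℝ]} {I w : ℍ[ℝ]} {z : ℂ}
    (h : symmetrization f I w z = 0) :
    ∃ J ∈ imagUnits, stemRe f I z + J * stemIm f I z = w ∧
      (stemIm f I z ≠ 0 → J = -((stemRe f I z - w) * (stemIm f I z)⁻¹)) := by
  obtain ⟨hn, hi⟩ := symmetrization_eq_zero_iff.1 h
  by_cases hc : stemIm f I z = 0
  · obtain ⟨J, hJ⟩ := imagUnits_nonempty
    refine ⟨J, hJ, ?_, fun h => absurd hc h⟩
    rw [hc, norm_zero, norm_eq_zero, sub_eq_zero] at hn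
    rw [hc, mul_zero, add_zero, hn]
  · refine ⟨_, mul_inv_mem_imagUnits hc hn hi, ?_, fun _ => rfl⟩
    rw [neg_mul, inv_mul_cancel_right₀ hc]
    abel

theorem differentiableOn_symmetrization {f : ℍ[ℝ] → ℍ[ℝ]} {Ω : Set ℍ[ℝ]} (hs : IsSymmetric Ω)
    (hf : IsRegularOn f Ω) {I : ℍ[ℝ]} (hI : I ∈ imagUnits) (ho : IsOpen (slice Ω I)) (w : ℍ[ℝ]) :
    DifferentiableOn ℂ (symmetrization f I w) (slice Ω I) := by
  refine DifferentiableOn.fun_sum fun k _ => ?_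
  exact ((differentiableOn_stemComp hs hf hI ho _).sub_const _).pow 2

theorem continuousAt_symmetrization {f : ℍ[ℝ] → ℍ[ℝ]} {Ω : Set ℍ[ℝ]} (hs : IsSymmetric Ω)
    (hf : IsRegularOn f Ω) {I : ℍ[ℝ]} (hI : I ∈ imagUnits) (ho : IsOpen (slice Ω I)) (w : ℍ[ℝ])
    {z : ℂ} (hz : z ∈ slice Ω I) :
    ContinuousAt (fun p : ℍ[ℝ] × ℂ => symmetrization f I p.1 p.2) (w, z) := by
  refine tendsto_finsetSum _ fun k _ => ?_
  have h1 : ContinuousAt (fun p : ℍ[ℝ] × ℂ =>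
      stemComp f I (stdOrthonormalBasis ℝ ℍ[ℝ] k) p.2) (w, z) :=
    ContinuousAt.comp (g := stemComp f I (stdOrthonormalBasis ℝ ℍ[ℝ] k)) (f := Prod.snd)
      ((differentiableOn_stemComp hs hf hI ho _).continuousOn.continuousAt (ho.mem_nhds hz))
      continuousAt_snd
  have h2 : ContinuousAt (fun p : ℍ[ℝ] × ℂ =>
      (⟪p.1, stdOrthonormalBasis ℝ ℍ[ℝ] k⟫ : ℂ)) (w, z) := by
    refine Continuous.continuousAt ?_
    fun_prop
  exact (h1.sub h2).pow 2

/-- At real points the symmetrization is `‖f - w‖²`, so its vanishing forces `f = w` on the real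
axis, and from there on every slice. -/
theorem eqOn_const_of_symmetrization_eventually_eq_zero {f : ℍ[ℝ] → ℍ[ℝ]} {Ω : Set ℍ[ℝ]}
    (hΩ : IsSliceDomain Ω) (hs : IsSymmetric Ω) (hf : IsRegularOn f Ω) {I w : ℍ[ℝ]}
    (hI : I ∈ imagUnits) {z : ℂ} (hz : z ∈ slice Ω I)
    (h : ∀ᶠ u in 𝓝 z, symmetrization f I w u = 0) : ∀ q ∈ Ω, f q = w := by
  obtain ⟨x, hx⟩ := hΩ.exists_ofReal_mem_slice I
  obtain ⟨ho, hc⟩ := hΩ.2.2 I hI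
  have h0 : EqOn (symmetrization f I w) (fun _ => 0) (slice Ω I) :=
    ((differentiableOn_symmetrization hs hf hI ho w).analyticOnNhd
      ho).eqOn_of_preconnected_of_eventuallyEq analyticOnNhd_const hc.isPreconnected hz h
  have hreal : ∀ u ∈ slice Ω I, u.im = 0 → sliceFun f I u = w := fun u hu him => by
    have := (symmetrization_eq_zero_iff.1 (h0 hu)).1
    rwa [stemIm_of_im_eq_zero f I him, stemRe_of_im_eq_zero f I him, norm_zero, norm_eq_zero,
      sub_eq_zero] at this
  intro q hq
  obtain ⟨J, hJ, u, rfl⟩ := exists_eq_slicePoint q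
  have hIJ := hs.slice_eq hI hJ
  have hu : u ∈ slice Ω I := hIJ ▸ hq
  refine eq_of_sliceFunctional_eq (I := J) fun v => ?_
  refine eqOn_of_eq_of_im_eq_zero (g := fun z => sliceFunctional J v (sliceFun f J z))
    (h := fun _ => sliceFunctional J v w) ho hc.isPreconnected hx ?_
    (differentiableOn_const _) (fun t ht him => ?_) hu
  · rw [hIJ]
    exact differentiableOn_sliceFunctional hf hJ (hIJ ▸ ho) v
  · simp only [← hreal t ht him, sliceFun, slicePoint_of_im_eq_zero him J I]

theorem subset_closure_degenerateSet_of_const {f : ℍ[ℝ] → ℍ[ℝ]} {Ω : Set ℍ[ℝ]} (ho : IsOpen Ω)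
    (hs : IsSymmetric Ω) {w : ℍ[ℝ]} (h : ∀ q ∈ Ω, f q = w) : Ω ⊆ closure (degenerateSet f Ω) := by
  have key : ∀ J ∈ imagUnits, ∀ u : ℂ, slicePoint J u ∈ Ω → u.im ≠ 0 →
      slicePoint J u ∈ degenerateSet f Ω := fun J hJ u hu him =>
    have hsub := hs u.re u.im J hJ hu
    ⟨u.re, u.im, him, hsub, ⟨w, fun p hp => h p (hsub hp)⟩, slicePoint_mem_sphere hJ u⟩
  intro q hq
  obtain ⟨J, hJ, u, rfl⟩ := exists_eq_slicePoint q
  by_cases him : u.im = 0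
  -- A real point lies on no sphere with `y ≠ 0`, but it is a limit of nonreal points of its slice.
  · have ht : Tendsto (fun t : ℝ => slicePoint J (u + t * Complex.I)) (𝓝[≠] 0)
        (𝓝 (slicePoint J u)) := by
      have : ContinuousAt (fun t : ℝ => slicePoint J (u + t * Complex.I)) 0 := by
        refine Continuous.continuousAt ?_
        unfold slicePoint
        have : Continuous ((↑) : ℝ → ℍ[ℝ]) := Quaternion.continuous_coe
        fun_prop
      simpa [ContinuousAt] using this.mono_left (nhdsWithin_le_nhds (s := {0}ᶜ))
    refine mem_closure_of_tendsto ht ?_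
    filter_upwards [ht (ho.mem_nhds hq), self_mem_nhdsWithin] with t ht1 ht2
    exact key J hJ _ ht1 (by simpa [him] using ht2)
  · exact subset_closure (key J hJ u hq him)

/-! ### Persistence of zeros and the open mapping theorem -/

/-- A Hurwitz-type statement, obtained from the quantitative open mapping theorem on a disc whose
boundary avoids the zeros of `N w₀`. -/
theorem eventually_exists_zero_of_continuousAt {X : Type*} [TopologicalSpace X] {N : X → ℂ → ℂ}
    {D : Set ℂ} (hD : IsOpen D) (hN : ∀ w, DifferentiableOn ℂ (N w) D) {w₀ : X} {z₀ : ℂ}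
    (hz₀ : z₀ ∈ D) (hcont : ∀ z ∈ D, ContinuousAt (fun p : X × ℂ => N p.1 p.2) (w₀, z))
    (h0 : N w₀ z₀ = 0) (hne : ¬ ∀ᶠ z in 𝓝 z₀, N w₀ z = 0) {V : Set ℂ} (hV : V ∈ 𝓝 z₀) :
    ∀ᶠ w in 𝓝 w₀, ∃ z ∈ V, N w z = 0 := by
  have han : AnalyticAt ℂ (N w₀) z₀ := (hN w₀).analyticAt (hD.mem_nhds hz₀)
  have hne' := han.eventually_eq_zero_or_eventually_ne_zero.resolve_left hne
  rw [eventually_nhdsWithin_iff] at hne'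
  obtain ⟨r, hr, hball⟩ := nhds_basis_closedBall.mem_iff.1
    (inter_mem hne' (inter_mem hV (hD.mem_nhds hz₀)))
  have hballD : closedBall z₀ r ⊆ D := fun z hz => (hball hz).2.2
  have hsphere : ∀ z ∈ Metric.sphere z₀ r, N w₀ z ≠ 0 := fun z hz =>
    (hball (sphere_subset_closedBall hz)).1 (ne_of_mem_sphere hz hr.ne')
  obtain ⟨ε, hε, hεle⟩ : ∃ ε > 0, ∀ z ∈ Metric.sphere z₀ r, ε ≤ ‖N w₀ z‖ := by
    obtain ⟨m, hm, hmin⟩ := (isCompact_sphere z₀ r).exists_isMinOn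
      (NormedSpace.sphere_nonempty.2 hr.le)
      (((hN w₀).continuousOn.mono (sphere_subset_closedBall.trans hballD)).norm)
    exact ⟨‖N w₀ m‖, norm_pos_iff.2 (hsphere m hm), fun z hz => hmin hz⟩
  -- With centre value below `ε / 4` and boundary values above `3 * ε / 4`, the two differ by at
  -- least `ε / 2`; the image then contains the ball of radius `ε / 4` about `N w z₀`, and so `0`.
  have h1 : ∀ᶠ w in 𝓝 w₀, ‖N w z₀‖ < ε / 4 := by
    have : ContinuousAt (fun w => N w z₀) w₀ :=
      ContinuousAt.comp (g := fun p : X × ℂ => N p.1 p.2) (f := fun w => (w, z₀)) (hcont z₀ hz₀)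
        (by fun_prop)
    exact this.norm.eventually_lt_const (by simpa [h0] using hε)
  have h2 : ∀ᶠ w in 𝓝 w₀, ∀ z ∈ Metric.sphere z₀ r, 3 * ε / 4 < ‖N w z‖ := by
    refine (isCompact_sphere z₀ r).eventually_forall_of_forall_eventually
      (P := fun w z => 3 * ε / 4 < ‖N w z‖) fun z hz => ?_
    refine (hcont z (hballD (sphere_subset_closedBall hz))).norm.eventually_const_lt ?_
    have := hεle z hz
    dsimp only
    linarith
  filter_upwards [h1, h2] with w hw1 hw2
  have hsub : ∀ z ∈ Metric.sphere z₀ r, ε / 2 ≤ ‖N w z - N w z₀‖ := fun z hz => by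
    have := norm_sub_norm_le (N w z) (N w z₀)
    have := hw2 z hz
    linarith
  have hfreq : ∃ᶠ z in 𝓝 z₀, N w z ≠ N w z₀ := by
    intro hev
    have hev' : N w =ᶠ[𝓝 z₀] fun _ => N w z₀ := hev.mono fun z hz => not_not.1 hz
    have heq := (((hN w).analyticOnNhd hD).mono hballD).eqOn_of_preconnected_of_eventuallyEq
      analyticOnNhd_const (convex_closedBall z₀ r).isPreconnected (mem_closedBall_self hr.le) hev'
    obtain ⟨z, hz⟩ : (Metric.sphere z₀ r).Nonempty := NormedSpace.sphere_nonempty.2 hr.le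
    have := hsub z hz
    rw [heq (sphere_subset_closedBall hz), sub_self, norm_zero] at this
    linarith
  have hdiff : DiffContOnCl ℂ (N w) (ball z₀ r) :=
    (hN w).diffContOnCl_ball hballD
  obtain ⟨z, hz, hz0⟩ := hdiff.ball_subset_image_closedBall hr hsub hfreq
    (show (0 : ℂ) ∈ ball (N w z₀) (ε / 2 / 2) by
      rw [mem_ball, dist_comm, dist_zero_right]
      linarith)
  exact ⟨z, (hball hz).2.1, hz0⟩

theorem continuousAt_sliceFun {f : ℍ[ℝ] → ℍ[ℝ]} {Ω : Set ℍ[ℝ]} (hf : IsRegularOn f Ω) {I : ℍ[ℝ]}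
    (hI : I ∈ imagUnits) (ho : IsOpen (slice Ω I)) {z : ℂ} (hz : z ∈ slice Ω I) :
    ContinuousAt (sliceFun f I) z :=
  (hf I hI).1.continuousOn.continuousAt (ho.mem_nhds hz)

theorem nhds_le_map_of_notMem_closure_degenerateSet {f : ℍ[ℝ] → ℍ[ℝ]} {Ω : Set ℍ[ℝ]}
    (hΩ : IsSliceDomain Ω) (hs : IsSymmetric Ω) (hf : IsRegularOn f Ω) {q : ℍ[ℝ]} (hq : q ∈ Ω)
    (hqd : q ∉ closure (degenerateSet f Ω)) : 𝓝 (f q) ≤ map f (𝓝 q) := by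
  obtain ⟨I, hI, z₀, rfl⟩ := exists_eq_slicePoint q
  have hz₀ : z₀ ∈ slice Ω I := hq
  have ho := (hΩ.2.2 I hI).1
  set w₀ := f (slicePoint I z₀)
  have hrep₀ : stemRe f I z₀ + I * stemIm f I z₀ = w₀ :=
    (representation_formula hΩ hs hf hI hI hz₀).symm
  intro S hS
  rw [mem_map] at hS
  suffices hmain : ∀ᶠ w in 𝓝 w₀, ∃ p ∈ f ⁻¹' S, f p = w by
    filter_upwards [hmain] with w ⟨p, hp, hpw⟩
    exact hpw ▸ hp
  have hzero : ∀ V ∈ 𝓝 z₀, ∀ᶠ w in 𝓝 w₀, ∃ z ∈ V, symmetrization f I w z = 0 := fun V hV =>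
    eventually_exists_zero_of_continuousAt ho
      (fun w => differentiableOn_symmetrization hs hf hI ho w) hz₀
      (fun z hz => continuousAt_symmetrization hs hf hI ho w₀ hz)
      (symmetrization_eq_zero_of_eq hI hrep₀)
      (fun hev => hqd (subset_closure_degenerateSet_of_const hΩ.1.1 hs
        (eqOn_const_of_symmetrization_eventually_eq_zero hΩ hs hf hI hz₀ hev) hq)) hV
  have hDz := ho.mem_nhds hz₀
  by_cases him : z₀.im = 0
  -- Over a real `z₀` all units give the same point, so `J` need not be controlled; the radius `ε /
  -- 2` offsets the Lipschitz constant `2` of `slicePoint J`.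
  · obtain ⟨ε, hε, hball⟩ := Metric.mem_nhds_iff.1 hS
    filter_upwards [hzero _ (inter_mem hDz (ball_mem_nhds z₀ (half_pos hε)))] with w ⟨z, hz, hw⟩
    obtain ⟨J, hJ, hJw, -⟩ := exists_of_symmetrization_eq_zero hw
    refine ⟨slicePoint J z, hball ?_, (representation_formula hΩ hs hf hI hJ hz.1).trans hJw⟩
    rw [slicePoint_of_im_eq_zero him I J, mem_ball, dist_eq_norm]
    have h1 := norm_slicePoint_sub_le hJ z z₀
    have h2 := mem_ball_iff_norm.1 hz.2
    linarith
  · have hc₀ : stemIm f I z₀ ≠ 0 := by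
      intro hc
      refine hqd (subset_closure ⟨z₀.re, z₀.im, him, hs _ _ I hI hq, ⟨stemRe f I z₀, ?_⟩,
        slicePoint_mem_sphere hI z₀⟩)
      rintro _ ⟨J, hJ, rfl⟩
      have := representation_formula hΩ hs hf hI hJ hz₀
      rwa [hc, mul_zero, add_zero] at this
    have hconj : ContinuousAt (fun z => sliceFun f I (conj z)) z₀ :=
      ContinuousAt.comp (f := fun z : ℂ => conj z)
        (continuousAt_sliceFun hf hI ho (hs.conj_mem_slice hI hz₀))
        Complex.continuous_conj.continuousAt
    have hslice := continuousAt_sliceFun hf hI ho hz₀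
    have hcRe : ContinuousAt (stemRe f I) z₀ := (hslice.add hconj).const_smul (1 / 2 : ℝ)
    have hcIm : ContinuousAt (stemIm f I) z₀ :=
      (continuousAt_const.mul (hconj.sub hslice)).const_smul (1 / 2 : ℝ)
    have hJ₀ : I = -((stemRe f I z₀ - w₀) * (stemIm f I z₀)⁻¹) := by
      rw [← hrep₀, sub_add_cancel_left, neg_mul, neg_neg, mul_inv_cancel_right₀ hc₀]
    -- The preimage rebuilt from `(w, z)` by the formula for `J` varies continuously and equals `q`
    -- at `(w₀, z₀)`. Off the zeros of `symmetrization` the formula need not give a unit, which is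
    -- harmless for continuity.
    have hΨ : ContinuousAt (fun p : ℍ[ℝ] × ℂ =>
        slicePoint (-((stemRe f I p.2 - p.1) * (stemIm f I p.2)⁻¹)) p.2) (w₀, z₀) := by
      have hRe' : ContinuousAt (fun p : ℍ[ℝ] × ℂ => stemRe f I p.2) (w₀, z₀) :=
        ContinuousAt.comp (g := stemRe f I) (f := Prod.snd) hcRe continuousAt_snd
      have hIm' : ContinuousAt (fun p : ℍ[ℝ] × ℂ => stemIm f I p.2) (w₀, z₀) :=
        ContinuousAt.comp (g := stemIm f I) (f := Prod.snd) hcIm continuousAt_snd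
      have hcoe : Continuous ((↑) : ℝ → ℍ[ℝ]) := Quaternion.continuous_coe
      have h1 : ContinuousAt (fun p : ℍ[ℝ] × ℂ => (p.2.re : ℍ[ℝ])) (w₀, z₀) :=
        Continuous.continuousAt (by fun_prop)
      have h2 : ContinuousAt (fun p : ℍ[ℝ] × ℂ => (p.2.im : ℍ[ℝ])) (w₀, z₀) :=
        Continuous.continuousAt (by fun_prop)
      exact h1.add (h2.mul ((hRe'.sub continuousAt_fst).mul (hIm'.inv₀ hc₀)).neg)
    have hpre : ∀ᶠ p : ℍ[ℝ] × ℂ in 𝓝 (w₀, z₀),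
        slicePoint (-((stemRe f I p.2 - p.1) * (stemIm f I p.2)⁻¹)) p.2 ∈ f ⁻¹' S := by
      refine hΨ ?_
      dsimp only
      rwa [← hJ₀]
    rw [nhds_prod_eq] at hpre
    obtain ⟨P, hP, Q, hQ, hPQ⟩ := eventually_prod_iff.1 hpre
    filter_upwards [hP, hzero _ (inter_mem hDz (inter_mem (hcIm.eventually_ne hc₀) hQ))]
      with w hwP ⟨z, ⟨hzD, hzc, hzQ⟩, hw⟩
    obtain ⟨J, hJ, hJw, hJeq⟩ := exists_of_symmetrization_eq_zero hw
    refine ⟨slicePoint J z, ?_, (representation_formula hΩ hs hf hI hJ hzD).trans hJw⟩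
    rw [hJeq hzc]
    exact hPQ hwP hzQ

end SliceRegular

theorem mainTheorem5 (Ω : Set ℍ[ℝ]) (hΩ : SliceRegular.IsSliceDomain Ω)
    (hsymm : SliceRegular.IsSymmetric Ω) (f : ℍ[ℝ] → ℍ[ℝ])
    (hf : SliceRegular.IsRegularOn f Ω) :
    IsOpenMap ((Ω \ closure (SliceRegular.degenerateSet f Ω)).domRestrict f) := by
  have ho : IsOpen (Ω \ closure (SliceRegular.degenerateSet f Ω)) := hΩ.1.1.sdiff isClosed_closure
  refine IsOpenMap.of_nhds_le fun q => ?_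
  refine (SliceRegular.nhds_le_map_of_notMem_closure_degenerateSet hΩ hsymm hf q.2.1 q.2.2).trans ?_
  rw [← map_nhds_subtype_coe_eq_nhds q.2 (ho.mem_nhds q.2), Filter.map_map]
  exact le_rfl
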